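/- For $z\in\mathbb R$ write $e(z)=\exp(2\pi i z)$, and for $N\in\mathbb N$ and $x,t\in\mathbb R$ let $$u_N(x,t)=\sum_{n=1}^{N} e(xn+tn^2),$$ the solution of the Schrödinger equation $2\pi u_t+iu_{xx}=0$ with initial data $u(x,0)=\sum_{n=1}^N e(xn)$. 1. For every $\varepsilon>0$ there is $N_0=N_0(\varepsilon)$ such that for all $N\ge N_0$, all $(x_0,t_0)\in[0,1)^2$ and all real $\delta\ge N^{-3/8}$, there exists $t\in[t_0,t_0+\delta]$ with $$\int_{x_0}^{x_0+\delta}|u_N(x,t)|^2\,dx\le \delta N^{5/4+\varepsilon}.$$ 2. For every (arbitrarily small) $c>0$ there are $\kappa=\kappa(c)>0$ and $N_0=N_0(c)$ such that for all $N\ge N_0$, all $(x_0,t_0)\in[0,1)^2$ and all real $\delta\ge c/N$, there exists $t\in[t_0,t_0+\delta]$ with $$\int_{x_0}^{x_0+\delta}|u_N(x,t)|^2\,dx\ge \kappa\,\delta.$$ -/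

import Mathlib

/-- The additive character `e(z) = exp(2πiz)`. -/
noncomputable def eChar (z : ℝ) : ℂ :=
  Complex.exp (2 * (Real.pi : ℂ) * Complex.I * (z : ℂ))

/-- The solution `u(x, t) = ∑_{n=1}^N e(xn + tn²)` of the periodic Schrödinger equation
`2π u_t + i u_xx = 0` with initial data `u(x, 0) = ∑_{n=1}^N e(xn)`. -/
noncomputable def schrodingerSum (N : ℕ) (x t : ℝ) : ℂ :=
  ∑ n ∈ Finset.Icc 1 N, eChar (x * (n : ℝ) + t * (n : ℝ) ^ 2)

/-- The quantity `ρ(t, [x₀, x₀ + δ]) = ∫_{x₀}^{x₀+δ} |u(x, t)|² dx`. -/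
noncomputable def localMass (N : ℕ) (x₀ δ t : ℝ) : ℝ :=
  ∫ x in x₀..(x₀ + δ), ‖schrodingerSum N x t‖ ^ 2

/-! By Fubini, bounds on the time integral of `‖u‖²` that are uniform in `x` pass to some single
time, so both parts concern `∫ ‖u(x,t)‖² dt` at fixed `x`.

Upper bound (`timeIntegral_le`): the diagonal gives `Nδ`. Off the diagonal the frequency `n² - m² =
(n - m)(n + m)` leaves at most `1 / (n|n - m|)`, with total `O(log² N)`, negligible against `Nδ`
when `δ ≥ N^(-3/8)`.

Lower bound: put `n = N - k`, so that up to a unimodular factor the frequencies are `k² - 2Nk`.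
Averaging twice over times of order `1/N` makes the `k`-th coefficient `O(k⁻²)` and keeps modulus 1
at `k = 0`. At time `θ/(2N)` the phase is `-kθ` plus a small quadratic correction, so the averaged
sum is nearly a polynomial `p` on an arc, with `|p(0)| = 1` and bounded coefficient sum
(`norm_polynomial_le`). By the maximum principle `p` cannot be small on the whole arc
(`one_le_mul_pow_of_arc_bound`). Cauchy–Schwarz turns this into an `L²` bound on a window `c/N`, and
longer intervals are tiled by windows. -/

/-! ### The additive character. -/

lemma eChar_add (y z : ℝ) : eChar (y + z) = eChar y * eChar z := by
  unfold eChar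
  rw [← Complex.exp_add]
  push_cast
  ring_nf

lemma eChar_zero : eChar 0 = 1 := by simp [eChar]

lemma norm_eChar (z : ℝ) : ‖eChar z‖ = 1 := by
  have : eChar z = Complex.exp ((2 * Real.pi * z : ℝ) * Complex.I) := by
    unfold eChar; push_cast; ring_nf
  rw [this, Complex.norm_exp_ofReal_mul_I]

lemma continuous_eChar : Continuous eChar := by
  unfold eChar; fun_prop

lemma eChar_neg (z : ℝ) : eChar (-z) = (starRingEnd ℂ) (eChar z) := by
  unfold eChar
  rw [← Complex.exp_conj]
  simp [Complex.conj_ofNat]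

lemma eChar_nat_mul (n : ℕ) (z : ℝ) : eChar (n * z) = eChar z ^ n := by
  unfold eChar
  rw [← Complex.exp_nat_mul]
  push_cast
  ring_nf

/-- Product of the bounds `2` and `2π|y|`. With `y = k²τ` it costs only one factor `k`, which `k⁻²`
coefficients absorb up to a logarithm. -/
lemma norm_eChar_sub_one_sq_le (y : ℝ) : ‖eChar y - 1‖ ^ 2 ≤ 4 * Real.pi * |y| := by
  have h1 : ‖eChar y - 1‖ ≤ 2 * Real.pi * |y| := by
    have : eChar y = Complex.exp (Complex.I * (2 * Real.pi * y : ℝ)) := by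
      unfold eChar; push_cast; ring_nf
    rw [this]
    refine (Real.norm_exp_I_mul_ofReal_sub_one_le).trans_eq ?_
    rw [Real.norm_eq_abs, abs_mul, abs_of_pos Real.two_pi_pos]
  have h2 : ‖eChar y - 1‖ ≤ 2 := by
    refine (norm_sub_le _ _).trans ?_
    rw [norm_eChar, norm_one]; norm_num
  nlinarith [norm_nonneg (eChar y - 1)]

lemma norm_integral_eChar_le {μ : ℝ} (hμ : μ ≠ 0) (a b : ℝ) :
    ‖∫ t in a..b, eChar (μ * t)‖ ≤ 1 / (Real.pi * |μ|) := by
  have hne : (2 * Real.pi * Complex.I * μ : ℂ) ≠ 0 := by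
    simp [Real.pi_ne_zero, hμ]
  have h : ∀ t : ℝ, eChar (μ * t) = Complex.exp ((2 * Real.pi * Complex.I * μ : ℂ) * t) := by
    intro t; unfold eChar; push_cast; ring_nf
  have hn : ‖(2 * Real.pi * Complex.I * μ : ℂ)‖ = 2 * (Real.pi * |μ|) := by
    simp [abs_of_pos Real.pi_pos, mul_assoc]
  have hpos : 0 < Real.pi * |μ| := by positivity
  simp_rw [h]
  rw [integral_exp_mul_complex hne, ← h, ← h, norm_div, hn]
  have h2 : ‖eChar (μ * b) - eChar (μ * a)‖ ≤ 2 := by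
    refine (norm_sub_le _ _).trans ?_
    rw [norm_eChar, norm_eChar]; norm_num
  rw [div_le_div_iff₀ (by positivity) hpos]
  nlinarith

/-! ### From time averages at fixed `x` to a single good time. -/

lemma continuous_schrodingerSum (N : ℕ) :
    Continuous (fun q : ℝ × ℝ => schrodingerSum N q.1 q.2) := by
  unfold schrodingerSum
  refine continuous_finsetSum _ fun n _ => continuous_eChar.comp (by fun_prop)

/-- Integrating in the two orders: the `t`-average of the local mass equals the `x`-integral of
the time averages. -/
lemma integral_localMass (N : ℕ) (x₀ t₀ δ : ℝ) :
    ∫ t in t₀..(t₀ + δ), localMass N x₀ δ t =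
      ∫ x in x₀..(x₀ + δ), ∫ t in t₀..(t₀ + δ), ‖schrodingerSum N x t‖ ^ 2 := by
  unfold localMass
  refine MeasureTheory.intervalIntegral_intervalIntegral_swap ?_
  refine (Continuous.integrableOn_Icc (a := (min t₀ (t₀ + δ), min x₀ (x₀ + δ)))
    (b := (max t₀ (t₀ + δ), max x₀ (x₀ + δ)))
    (((continuous_schrodingerSum N).comp continuous_swap).norm.pow 2)).mono_set ?_
  rw [← Set.Icc_prod_Icc]
  exact Set.prod_mono Set.Ioc_subset_Icc_self Set.Ioc_subset_Icc_self

lemma continuous_localMass (N : ℕ) (x₀ δ : ℝ) : Continuous (localMass N x₀ δ) := by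
  unfold localMass
  refine intervalIntegral.continuous_parametric_intervalIntegral_of_continuous' ?_ _ _
  exact ((continuous_schrodingerSum N).comp continuous_swap).norm.pow 2

lemma continuous_timeIntegral (N : ℕ) (t₀ δ : ℝ) :
    Continuous fun x => ∫ t in t₀..(t₀ + δ), ‖schrodingerSum N x t‖ ^ 2 := by
  refine intervalIntegral.continuous_parametric_intervalIntegral_of_continuous' ?_ _ _
  exact (continuous_schrodingerSum N).norm.pow 2

lemma exists_localMass_le {N : ℕ} {x₀ t₀ δ K : ℝ} (hδ : 0 < δ)
    (h : ∀ x, ∫ t in t₀..(t₀ + δ), ‖schrodingerSum N x t‖ ^ 2 ≤ K * δ) :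
    ∃ t ∈ Set.Icc t₀ (t₀ + δ), localMass N x₀ δ t ≤ δ * K := by
  by_contra! hc
  have h1 : ∫ t in t₀..(t₀ + δ), (δ * K) < ∫ t in t₀..(t₀ + δ), localMass N x₀ δ t := by
    refine intervalIntegral.integral_lt_integral_of_continuousOn_of_le_of_exists_lt (by linarith)
      continuousOn_const (continuous_localMass N x₀ δ).continuousOn
      (fun t ht => (hc t (Set.Ioc_subset_Icc_self ht)).le)
      ⟨t₀, ⟨le_rfl, by linarith⟩, hc t₀ ⟨le_rfl, by linarith⟩⟩
  have h2 : ∫ x in x₀..(x₀ + δ), ∫ t in t₀..(t₀ + δ), ‖schrodingerSum N x t‖ ^ 2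
      ≤ ∫ x in x₀..(x₀ + δ), K * δ :=
    intervalIntegral.integral_mono_on (by linarith)
      ((continuous_timeIntegral N t₀ δ).intervalIntegrable _ _) (by simp) (fun x _ => h x)
  rw [integral_localMass] at h1
  simp only [intervalIntegral.integral_const, smul_eq_mul] at h1 h2
  nlinarith

lemma exists_le_localMass {N : ℕ} {x₀ t₀ δ K : ℝ} (hδ : 0 < δ)
    (h : ∀ x, K * δ ≤ ∫ t in t₀..(t₀ + δ), ‖schrodingerSum N x t‖ ^ 2) :
    ∃ t ∈ Set.Icc t₀ (t₀ + δ), K * δ ≤ localMass N x₀ δ t := by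
  by_contra! hc
  have h1 : ∫ t in t₀..(t₀ + δ), localMass N x₀ δ t < ∫ t in t₀..(t₀ + δ), (K * δ) := by
    refine intervalIntegral.integral_lt_integral_of_continuousOn_of_le_of_exists_lt (by linarith)
      (continuous_localMass N x₀ δ).continuousOn continuousOn_const
      (fun t ht => (hc t (Set.Ioc_subset_Icc_self ht)).le)
      ⟨t₀, ⟨le_rfl, by linarith⟩, hc t₀ ⟨le_rfl, by linarith⟩⟩
  have h2 : ∫ x in x₀..(x₀ + δ), K * δ
      ≤ ∫ x in x₀..(x₀ + δ), ∫ t in t₀..(t₀ + δ), ‖schrodingerSum N x t‖ ^ 2 :=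
    intervalIntegral.integral_mono_on (by linarith) (by simp)
      ((continuous_timeIntegral N t₀ δ).intervalIntegrable _ _) (fun x _ => h x)
  rw [integral_localMass] at h1
  simp only [intervalIntegral.integral_const, smul_eq_mul] at h1 h2
  nlinarith

/-! ### Upper bound: mean square in time. -/

/-- The harmonic sum `∑_{k=1}^N 1/k` is `O(N^{1/4})`. -/
lemma sum_inv_le (N : ℕ) (hN : 1 ≤ N) :
    ∑ k ∈ Finset.Icc 1 N, (1 : ℝ) / k ≤ 5 * (N : ℝ) ^ (1 / 4 : ℝ) := by
  have h1 := harmonic_le_one_add_log N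
  have h2 : ((harmonic N : ℚ) : ℝ) = ∑ k ∈ Finset.Icc 1 N, (1 : ℝ) / k := by
    rw [harmonic_eq_sum_Icc]; push_cast; simp
  have h3 : Real.log N ≤ (N : ℝ) ^ (1 / 4 : ℝ) / (1 / 4) :=
    Real.log_le_rpow_div (by positivity) (by norm_num)
  have h4 : 1 ≤ (N : ℝ) ^ (1 / 4 : ℝ) :=
    Real.one_le_rpow (by exact_mod_cast hN) (by norm_num)
  rw [← h2]
  linarith

/-- Each distance `k` is attained by at most two `m`, namely `n ± k`; the term `m = n` is `1 / 0 =
0`. -/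
lemma sum_inv_abs_sub_le (N n : ℕ) (hn : n ∈ Finset.Icc 1 N) :
    ∑ m ∈ Finset.Icc 1 N, 1 / |(n : ℝ) - m| ≤ 2 * ∑ k ∈ Finset.Icc 1 N, (1 : ℝ) / k := by
  rw [Finset.mem_Icc] at hn
  have h : ∀ m ∈ Finset.Icc 1 N, 1 / |(n : ℝ) - m| ≤
      ∑ k ∈ Finset.Icc 1 N, ((if n + k = m then (1 : ℝ) / k else 0) +
        (if n = m + k then (1 : ℝ) / k else 0)) := by
    intro m hm
    rw [Finset.mem_Icc] at hm
    have hnn : ∀ k ∈ Finset.Icc 1 N, 0 ≤ ((if n + k = m then (1 : ℝ) / k else 0) +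
        (if n = m + k then (1 : ℝ) / k else 0)) := by
      intro k _; positivity
    rcases lt_trichotomy n m with hlt | rfl | hlt
    · have hk : m - n ∈ Finset.Icc 1 N := by rw [Finset.mem_Icc]; omega
      refine le_trans ?_ (Finset.single_le_sum hnn hk)
      rw [if_pos (by omega), if_neg (by omega), add_zero, Nat.cast_sub hlt.le, abs_sub_comm,
        abs_of_nonneg (sub_nonneg.2 (by exact_mod_cast hlt.le))]
    · simpa using Finset.sum_nonneg hnn
    · have hk : n - m ∈ Finset.Icc 1 N := by rw [Finset.mem_Icc]; omega
      refine le_trans ?_ (Finset.single_le_sum hnn hk)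
      rw [if_neg (by omega), if_pos (by omega), zero_add, Nat.cast_sub hlt.le,
        abs_of_nonneg (sub_nonneg.2 (by exact_mod_cast hlt.le))]
  refine (Finset.sum_le_sum h).trans ?_
  rw [Finset.sum_comm, Finset.mul_sum]
  refine Finset.sum_le_sum fun k hk => ?_
  rw [Finset.sum_add_distrib, two_mul]
  refine add_le_add ?_ ?_
  · rw [Finset.sum_ite_eq]
    split_ifs <;> first | exact le_rfl | positivity
  · by_cases hkn : k ≤ n
    · have : ∀ m, (n = m + k) ↔ (n - k = m) := fun m => by omega
      simp_rw [this]
      rw [Finset.sum_ite_eq]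
      split_ifs <;> first | exact le_rfl | positivity
    · rw [Finset.sum_eq_zero fun m _ => if_neg (by omega)]
      positivity

lemma normSq_schrodingerSum (N : ℕ) (x t : ℝ) :
    ((‖schrodingerSum N x t‖ ^ 2 : ℝ) : ℂ) =
      ∑ n ∈ Finset.Icc 1 N, ∑ m ∈ Finset.Icc 1 N,
        eChar (x * ((n : ℝ) - m)) * eChar (((n : ℝ) ^ 2 - (m : ℝ) ^ 2) * t) := by
  rw [Complex.ofReal_pow, ← Complex.mul_conj']
  unfold schrodingerSum
  rw [map_sum, Finset.sum_mul_sum]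
  refine Finset.sum_congr rfl fun n _ => Finset.sum_congr rfl fun m _ => ?_
  rw [← eChar_neg, ← eChar_add, ← eChar_add]
  ring_nf

/-- Mean square of the exponential sum over a time interval, with a harmonic error term. -/
lemma timeIntegral_le (N : ℕ) (x t₀ δ : ℝ) (hδ : 0 ≤ δ) :
    ∫ t in t₀..(t₀ + δ), ‖schrodingerSum N x t‖ ^ 2 ≤
      N * δ + 2 * (∑ k ∈ Finset.Icc 1 N, (1 : ℝ) / k) ^ 2 := by
  have hcont : ∀ μ : ℝ, Continuous fun t : ℝ => eChar (μ * t) := fun μ =>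
    continuous_eChar.comp (by fun_prop)
  have hnn : 0 ≤ ∫ t in t₀..(t₀ + δ), ‖schrodingerSum N x t‖ ^ 2 :=
    intervalIntegral.integral_nonneg (by linarith) fun t _ => by positivity
  have hterm : ∀ n ∈ Finset.Icc 1 N, ∀ m ∈ Finset.Icc 1 N,
      ‖∫ t in t₀..(t₀ + δ),
        eChar (x * ((n : ℝ) - m)) * eChar (((n : ℝ) ^ 2 - (m : ℝ) ^ 2) * t)‖ ≤
      (if n = m then δ else 0) + 1 / (n : ℝ) * (1 / |(n : ℝ) - m|) := by
    intro n hn m hm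
    rw [Finset.mem_Icc] at hn hm
    rw [intervalIntegral.integral_const_mul, norm_mul, norm_eChar, one_mul]
    by_cases hnm : n = m
    · subst hnm
      simp [eChar_zero, abs_of_nonneg hδ]
    · have hne : (n : ℝ) - m ≠ 0 := sub_ne_zero.2 (by exact_mod_cast hnm)
      have hn0 : (0 : ℝ) < n := by exact_mod_cast hn.1
      have hm0 : (0 : ℝ) < m := by exact_mod_cast hm.1
      have hfac : |(n : ℝ) ^ 2 - (m : ℝ) ^ 2| = |(n : ℝ) - m| * (n + m) := by
        rw [← abs_of_pos (add_pos hn0 hm0), ← abs_mul]; ring_nf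
      have hpos : 0 < |(n : ℝ) - m| := abs_pos.2 hne
      have hμ : (n : ℝ) ^ 2 - (m : ℝ) ^ 2 ≠ 0 := by
        rw [← abs_pos, hfac]; positivity
      rw [if_neg hnm, zero_add, one_div_mul_one_div_rev]
      refine (norm_integral_eChar_le hμ _ _).trans ?_
      rw [hfac]
      refine one_div_le_one_div_of_le (by positivity) ?_
      have := Real.pi_gt_three
      nlinarith [mul_pos hpos hn0, mul_pos hpos hm0]
  calc ∫ t in t₀..(t₀ + δ), ‖schrodingerSum N x t‖ ^ 2
      = ‖((∫ t in t₀..(t₀ + δ), ‖schrodingerSum N x t‖ ^ 2 : ℝ) : ℂ)‖ := by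
        rw [Complex.norm_real, Real.norm_of_nonneg hnn]
    _ = ‖∑ n ∈ Finset.Icc 1 N, ∑ m ∈ Finset.Icc 1 N, ∫ t in t₀..(t₀ + δ),
          eChar (x * ((n : ℝ) - m)) * eChar (((n : ℝ) ^ 2 - (m : ℝ) ^ 2) * t)‖ := by
        rw [← intervalIntegral.integral_ofReal]
        simp_rw [normSq_schrodingerSum]
        rw [intervalIntegral.integral_finsetSum]
        · congr 1
          refine Finset.sum_congr rfl fun n _ => ?_
          rw [intervalIntegral.integral_finsetSum]
          exact fun m _ => (continuous_const.mul (hcont _)).intervalIntegrable _ _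
        · exact fun n _ => (continuous_finsetSum _ fun m _ =>
            continuous_const.mul (hcont _)).intervalIntegrable _ _
    _ ≤ ∑ n ∈ Finset.Icc 1 N, ∑ m ∈ Finset.Icc 1 N,
          ((if n = m then δ else 0) + 1 / (n : ℝ) * (1 / |(n : ℝ) - m|)) :=
        norm_sum_le_of_le _ fun n hn => norm_sum_le_of_le _ fun m hm => hterm n hn m hm
    _ ≤ ∑ n ∈ Finset.Icc 1 N,
          (δ + 1 / (n : ℝ) * (2 * ∑ k ∈ Finset.Icc 1 N, (1 : ℝ) / k)) := by
        refine Finset.sum_le_sum fun n hn => ?_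
        rw [Finset.sum_add_distrib, Finset.sum_ite_eq, if_pos hn, ← Finset.mul_sum]
        gcongr
        exact sum_inv_abs_sub_le N n hn
    _ = N * δ + 2 * (∑ k ∈ Finset.Icc 1 N, (1 : ℝ) / k) ^ 2 := by
        rw [Finset.sum_add_distrib, ← Finset.sum_mul]
        simp only [Finset.sum_const, Nat.card_Icc, nsmul_eq_mul, Nat.add_sub_cancel]
        ring

/-- For `δ ≥ N^{-3/8}` the time average of `|u|²` is at most `N^{5/4 + ε}`. -/
lemma exists_localMass_le_rpow {ε : ℝ} (hε : 0 < ε) {N : ℕ} (hN : 51 ^ 4 ≤ N) (x₀ t₀ : ℝ)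
    {δ : ℝ} (hδ : (N : ℝ) ^ (-(3 / 8) : ℝ) ≤ δ) :
    ∃ t ∈ Set.Icc t₀ (t₀ + δ), localMass N x₀ δ t ≤ δ * (N : ℝ) ^ (5 / 4 + ε : ℝ) := by
  have hN1 : (1 : ℝ) ≤ N := by exact_mod_cast (by omega : 1 ≤ N)
  have hN0 : (0 : ℝ) < N := by linarith
  have hδ0 : 0 < δ := lt_of_lt_of_le (Real.rpow_pos_of_pos hN0 _) hδ
  refine exists_localMass_le hδ0 fun x => (timeIntegral_le N x t₀ δ hδ0.le).trans ?_
  have hH := sum_inv_le N (by omega)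
  have hHn : 0 ≤ ∑ k ∈ Finset.Icc 1 N, (1 : ℝ) / k := Finset.sum_nonneg fun k _ => by positivity
  have hsq : (∑ k ∈ Finset.Icc 1 N, (1 : ℝ) / k) ^ 2 ≤ 25 * (N : ℝ) ^ (1 / 2 : ℝ) := by
    refine (pow_le_pow_left₀ hHn hH 2).trans_eq ?_
    rw [mul_pow, ← Real.rpow_natCast ((N : ℝ) ^ (1 / 4 : ℝ)), ← Real.rpow_mul hN0.le]
    norm_num
  -- There is room to spare: `Nδ ≥ N^(5/8)`.
  have hhalf : (N : ℝ) ^ (1 / 2 : ℝ) ≤ N * δ := by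
    calc (N : ℝ) ^ (1 / 2 : ℝ) ≤ (N : ℝ) ^ (1 + -(3 / 8) : ℝ) :=
          Real.rpow_le_rpow_of_exponent_le hN1 (by norm_num)
      _ = N * (N : ℝ) ^ (-(3 / 8) : ℝ) := by rw [Real.rpow_add hN0, Real.rpow_one]
      _ ≤ N * δ := by gcongr
  -- `51 = 1 + 2 · 25`: the diagonal plus twice the squared harmonic sum, in units of `Nδ`.
  have hquart : (51 : ℝ) ≤ (N : ℝ) ^ (1 / 4 : ℝ) := by
    have h4 : ((51 : ℝ) ^ (4 : ℝ)) ^ (1 / 4 : ℝ) = 51 := by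
      rw [← Real.rpow_mul (by norm_num)]; norm_num
    rw [← h4]
    refine Real.rpow_le_rpow (by positivity) ?_ (by norm_num)
    exact_mod_cast hN
  have hbig : 51 * (N : ℝ) ≤ (N : ℝ) ^ (5 / 4 + ε : ℝ) := by
    calc 51 * (N : ℝ) ≤ (N : ℝ) ^ (1 / 4 : ℝ) * N := by gcongr
      _ = (N : ℝ) ^ (1 / 4 + 1 : ℝ) := by rw [Real.rpow_add hN0, Real.rpow_one]
      _ ≤ (N : ℝ) ^ (5 / 4 + ε : ℝ) := Real.rpow_le_rpow_of_exponent_le hN1 (by linarith)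
  nlinarith [mul_le_mul_of_nonneg_right hbig hδ0.le]

/-! ### Lower bound: polynomials on an arc and averaging in time. -/

/-- A power series truncation `p` with `|p(0)| = 1` cannot be small on an arc of length `2π/M`:
apply the maximum principle to the product of its `M` rotations. -/
lemma one_le_mul_pow_of_arc_bound {N M : ℕ} {b : ℕ → ℂ} {B S : ℝ} (hN : 1 ≤ N) (hM : 1 ≤ M)
    (hb : ‖b 0‖ = 1) (hB : ∑ k ∈ Finset.range N, ‖b k‖ ≤ B)
    (hS : ∀ θ ∈ Set.Icc (0 : ℝ) (1 / M),
      ‖∑ k ∈ Finset.range N, b k * eChar (-θ) ^ k‖ ≤ S) :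
    1 ≤ S * B ^ (M - 1) := by
  have hM0 : (0 : ℝ) < M := by exact_mod_cast hM
  set p : ℂ → ℂ := fun z => ∑ k ∈ Finset.range N, b k * z ^ k with hp
  set Q : ℂ → ℂ := fun z => ∏ j ∈ Finset.range M, p (z * eChar (j / M)) with hQ
  have hpd : Differentiable ℂ p := by
    rw [hp]; fun_prop
  have hQd : Differentiable ℂ Q := by
    rw [hQ]
    refine Differentiable.fun_finsetProd fun j _ => hpd.comp (by fun_prop)
  have hp0 : p 0 = b 0 := by
    simp only [hp]
    rw [Finset.sum_eq_single 0]
    · simp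
    · intro k _ hk; simp [hk]
    · intro h; exact absurd (Finset.mem_range.2 hN) h
  have hQ0 : ‖Q 0‖ = 1 := by
    simp only [hQ, zero_mul, hp0, norm_prod, hb, Finset.prod_const_one]
  have hpB : ∀ z : ℂ, ‖z‖ = 1 → ‖p z‖ ≤ B := by
    intro z hz
    refine (norm_sum_le _ _).trans (le_trans (le_of_eq ?_) hB)
    simp [hz]
  rw [← hQ0]
  refine Complex.norm_le_of_forall_mem_frontier_norm_le (U := Metric.ball (0 : ℂ) 1)
    Metric.isBounded_ball hQd.diffContOnCl ?_ (subset_closure (by simp))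
  intro z hz
  rw [frontier_ball _ one_ne_zero, mem_sphere_zero_iff_norm] at hz
  obtain ⟨θ, hθ0, hθ1, rfl⟩ : ∃ θ : ℝ, 0 ≤ θ ∧ θ < 1 ∧ eChar (-θ) = z := by
    refine ⟨Int.fract (-(z.arg / (2 * Real.pi))), Int.fract_nonneg _, Int.fract_lt_one _, ?_⟩
    have h1 : -Int.fract (-(z.arg / (2 * Real.pi))) =
        z.arg / (2 * Real.pi) + (⌊-(z.arg / (2 * Real.pi))⌋ : ℝ) := by
      rw [← Int.self_sub_floor]; ring
    have h2 : ∀ n : ℤ, eChar n = 1 := by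
      intro n
      unfold eChar
      rw [Complex.exp_eq_one_iff]
      exact ⟨n, by push_cast; ring⟩
    rw [h1, eChar_add, h2, mul_one]
    unfold eChar
    have hpi : (Real.pi : ℂ) ≠ 0 := by exact_mod_cast Real.pi_ne_zero
    rw [show (2 * (Real.pi : ℂ) * Complex.I * ((z.arg / (2 * Real.pi) : ℝ) : ℂ)) =
      z.arg * Complex.I by push_cast; field_simp]
    have := Complex.norm_mul_exp_arg_mul_I z
    rwa [hz, Complex.ofReal_one, one_mul] at this
  -- The rotation by `i / M` carries `z` into the arc where `p` is at most `S`; the other `M - 1`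
  -- factors are at most `B`.
  set i := ⌊θ * M⌋₊ with hi
  have hi1 : (i : ℝ) ≤ θ * M := Nat.floor_le (by positivity)
  have hi2 : θ * M < i + 1 := Nat.lt_floor_add_one _
  have hiM : i < M := by
    have : (i : ℝ) < M := by nlinarith
    exact_mod_cast this
  have hrot : eChar (-θ) * eChar (i / M) = eChar (-(θ - i / M)) := by
    rw [← eChar_add]; ring_nf
  have hsmall : ‖p (eChar (-θ) * eChar (i / M))‖ ≤ S := by
    rw [hrot]
    refine hS _ ⟨?_, ?_⟩
    · rw [sub_nonneg, div_le_iff₀ hM0]; exact hi1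
    · rw [sub_le_iff_le_add, ← add_div, le_div_iff₀ hM0]; linarith
  have hS0 : 0 ≤ S := (norm_nonneg _).trans hsmall
  simp only [hQ, norm_prod]
  rw [← Finset.mul_prod_erase _ _ (Finset.mem_range.2 hiM)]
  refine mul_le_mul hsmall ?_ (Finset.prod_nonneg fun _ _ => norm_nonneg _) hS0
  refine (Finset.prod_le_prod (g := fun _ => B) (fun _ _ => norm_nonneg _)
    fun j _ => ?_).trans_eq ?_
  · exact hpB _ (by rw [norm_mul, norm_eChar, norm_eChar, one_mul])
  · rw [Finset.prod_const, Finset.card_erase_of_mem (Finset.mem_range.2 hiM), Finset.card_range]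

/-- Since `τ ≤ 2h`, every time `τ + a + b` stays in `[0, 4h]`. -/
lemma norm_double_integral_le {g : ℝ → ℂ} (hg : Continuous g) {h τ : ℝ} (hh : 0 ≤ h)
    (hτ0 : 0 ≤ τ) (hτ1 : τ ≤ 2 * h) :
    ‖∫ a in (0 : ℝ)..h, ∫ b in (0 : ℝ)..h, g (τ + a + b)‖ ≤ h * ∫ t in (0 : ℝ)..(4 * h), ‖g t‖ := by
  have key : ∀ a ∈ Set.uIoc 0 h, ‖∫ b in (0 : ℝ)..h, g (τ + a + b)‖ ≤
      ∫ t in (0 : ℝ)..(4 * h), ‖g t‖ := by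
    intro a ha
    rw [Set.uIoc_of_le hh] at ha
    refine (intervalIntegral.norm_integral_le_integral_norm hh).trans ?_
    rw [intervalIntegral.integral_comp_add_left (fun t => ‖g t‖)]
    refine intervalIntegral.integral_mono_interval (by linarith [ha.1]) (by linarith)
      (by linarith [ha.2]) (Filter.Eventually.of_forall fun t => norm_nonneg _)
      (hg.norm.intervalIntegrable _ _)
  refine (intervalIntegral.norm_integral_le_of_norm_le_const key).trans_eq ?_
  rw [sub_zero, abs_of_nonneg hh, mul_comm]

/-- The square is the reason for averaging twice: one average decays like `1/k`, which is not
summable. -/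
lemma double_integral_eChar (μ h τ : ℝ) :
    ∫ a in (0 : ℝ)..h, ∫ b in (0 : ℝ)..h, eChar (μ * (τ + a + b)) =
      eChar (μ * τ) * (∫ a in (0 : ℝ)..h, eChar (μ * a)) ^ 2 := by
  have : ∀ a b : ℝ, eChar (μ * (τ + a + b)) = eChar (μ * τ) * eChar (μ * a) * eChar (μ * b) := by
    intro a b
    rw [← eChar_add, ← eChar_add]; ring_nf
  simp_rw [this, intervalIntegral.integral_const_mul, intervalIntegral.integral_mul_const,
    intervalIntegral.integral_const_mul]
  ring

/-- Cauchy–Schwarz, from nonnegativity of the variance of `‖g‖`. -/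
lemma sq_integral_norm_le {g : ℝ → ℂ} (hg : Continuous g) {L : ℝ} (hL : 0 < L) :
    (∫ t in (0 : ℝ)..L, ‖g t‖) ^ 2 ≤ L * ∫ t in (0 : ℝ)..L, ‖g t‖ ^ 2 := by
  set A := ∫ t in (0 : ℝ)..L, ‖g t‖ with hA
  have h1 : 0 ≤ ∫ t in (0 : ℝ)..L, (‖g t‖ - A / L) ^ 2 :=
    intervalIntegral.integral_nonneg hL.le fun t _ => sq_nonneg _
  have hc := hg.norm
  have h2 : ∫ t in (0 : ℝ)..L, (‖g t‖ - A / L) ^ 2 =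
      (∫ t in (0 : ℝ)..L, ‖g t‖ ^ 2) - 2 * (A / L) * A + L * (A / L) ^ 2 := by
    have : ∀ t, (‖g t‖ - A / L) ^ 2 = ‖g t‖ ^ 2 - 2 * (A / L) * ‖g t‖ + (A / L) ^ 2 := by
      intro t; ring
    simp_rw [this]
    rw [intervalIntegral.integral_add, intervalIntegral.integral_sub,
      intervalIntegral.integral_const_mul, intervalIntegral.integral_const]
    · simp [hA]
    · exact (hc.pow 2).intervalIntegrable _ _
    · exact (continuous_const.mul hc).intervalIntegrable _ _
    · exact ((hc.pow 2).sub (continuous_const.mul hc)).intervalIntegrable _ _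
    · simp
  rw [h2] at h1
  have h3 : L * (A / L) ^ 2 = A ^ 2 / L := by field_simp
  have h4 : 2 * (A / L) * A = 2 * (A ^ 2 / L) := by ring
  rw [h3, h4] at h1
  have h5 : A ^ 2 / L ≤ ∫ t in (0 : ℝ)..L, ‖g t‖ ^ 2 := by linarith
  rwa [div_le_iff₀ hL, mul_comm] at h5

/-- Pointwise bound for the doubly averaged coefficients. -/
lemma norm_average_coeff_le {N k : ℕ} {c : ℝ} (hc : 0 < c) (hk : 1 ≤ k) (hkN : k < N) :
    ‖(∫ a in (0 : ℝ)..(c / (4 * N)), eChar (((k : ℝ) ^ 2 - 2 * N * k) * a)) ^ 2 /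
      ((c / (4 * N) : ℝ) : ℂ) ^ 2‖ ≤ 2 / c ^ 2 * ((k : ℝ) ^ 2)⁻¹ := by
  have hk0 : (0 : ℝ) < k := by exact_mod_cast hk
  have hkN' : (k : ℝ) < N := by exact_mod_cast hkN
  have hN0 : (0 : ℝ) < N := hk0.trans hkN'
  have habs : (k : ℝ) * N ≤ |(k : ℝ) ^ 2 - 2 * N * k| := by
    rw [abs_of_nonpos (by nlinarith)]; nlinarith
  have hne : (k : ℝ) ^ 2 - 2 * N * k ≠ 0 := by
    rw [← abs_pos]; exact lt_of_lt_of_le (by positivity) habs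
  have h1 := norm_integral_eChar_le hne 0 (c / (4 * N))
  have h2 : 1 / (Real.pi * |(k : ℝ) ^ 2 - 2 * N * k|) ≤ 1 / (3 * (k * N)) := by
    refine one_div_le_one_div_of_le (by positivity) ?_
    exact mul_le_mul Real.pi_gt_three.le habs (by positivity) Real.pi_pos.le
  rw [norm_div, norm_pow, norm_pow, Complex.norm_real, Real.norm_of_nonneg (by positivity)]
  rw [div_le_iff₀ (by positivity)]
  refine (pow_le_pow_left₀ (norm_nonneg _) (h1.trans h2) 2).trans ?_
  have : 2 / c ^ 2 * ((k : ℝ) ^ 2)⁻¹ * (c / (4 * N)) ^ 2 = (1 / 8) * (1 / (k * N)) ^ 2 := by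
    field_simp; norm_num
  rw [this]
  have : (1 / (3 * ((k : ℝ) * N))) ^ 2 = (1 / 9) * (1 / (k * N)) ^ 2 := by
    field_simp; norm_num
  rw [this]
  gcongr
  norm_num

/-- Replacing the quadratic phases by linear ones on a time window of length `O(1/N)`: the
resulting polynomial is controlled by the `L¹` norm of the exponential sum on the window. -/
lemma norm_polynomial_le {N : ℕ} {c : ℝ} (hc : 0 < c) (hc1 : c ≤ 1) (hN : 1 ≤ N) {a b : ℕ → ℂ}
    (ha : ∀ k, ‖a k‖ = 1)
    (hb : ∀ k, b k = a k *
      ((∫ s in (0 : ℝ)..(c / (4 * N)), eChar (((k : ℝ) ^ 2 - 2 * N * k) * s)) ^ 2 /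
        ((c / (4 * N) : ℝ) : ℂ) ^ 2))
    {θ : ℝ} (hθ0 : 0 ≤ θ) (hθ1 : θ ≤ c) :
    ‖∑ k ∈ Finset.range N, b k * eChar (-θ) ^ k‖ ≤
      (∫ t in (0 : ℝ)..(c / N), ‖∑ k ∈ Finset.range N,
        a k * eChar (((k : ℝ) ^ 2 - 2 * N * k) * t)‖) / (c / (4 * N)) +
      30 / c ^ 2 * (N : ℝ) ^ (-(1 / 4) : ℝ) := by
  have hN0 : (0 : ℝ) < N := by exact_mod_cast hN
  set h : ℝ := c / (4 * N) with hh
  have hh0 : 0 < h := by positivity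
  have h4 : c / N = 4 * h := by rw [hh]; field_simp
  set g : ℝ → ℂ := fun t => ∑ k ∈ Finset.range N, a k * eChar (((k : ℝ) ^ 2 - 2 * N * k) * t)
    with hg
  have hec : ∀ μ : ℝ, Continuous fun t : ℝ => eChar (μ * t) := fun μ =>
    continuous_eChar.comp (by fun_prop)
  have hgc : Continuous g := continuous_finsetSum _ fun k _ => continuous_const.mul (hec _)
  -- Chosen so that `-2Nk · τ = -kθ`.
  set τ : ℝ := θ / (2 * N) with hτ
  have hτ0 : 0 ≤ τ := by positivity
  have hτ1 : τ ≤ 2 * h := by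
    rw [hτ, hh, div_le_iff₀ (by positivity)]
    refine hθ1.trans (le_of_eq ?_)
    field_simp; norm_num
  have hcC : ((h : ℝ) : ℂ) ≠ 0 := by exact_mod_cast hh0.ne'
  have havg : ∑ k ∈ Finset.range N, b k * (eChar (-θ) ^ k * eChar ((k : ℝ) ^ 2 * τ)) =
      (∫ s in (0 : ℝ)..h, ∫ r in (0 : ℝ)..h, g (τ + s + r)) / (h : ℂ) ^ 2 := by
    have h1 : ∫ s in (0 : ℝ)..h, ∫ r in (0 : ℝ)..h, g (τ + s + r) =
        ∑ k ∈ Finset.range N, a k * ∫ s in (0 : ℝ)..h, ∫ r in (0 : ℝ)..h,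
          eChar (((k : ℝ) ^ 2 - 2 * N * k) * (τ + s + r)) := by
      simp only [hg]
      have hin : ∀ s : ℝ, ∫ r in (0 : ℝ)..h, ∑ k ∈ Finset.range N,
          a k * eChar (((k : ℝ) ^ 2 - 2 * N * k) * (τ + s + r)) =
          ∑ k ∈ Finset.range N, a k * ∫ r in (0 : ℝ)..h,
            eChar (((k : ℝ) ^ 2 - 2 * N * k) * (τ + s + r)) := by
        intro s
        rw [intervalIntegral.integral_finsetSum]
        · simp_rw [intervalIntegral.integral_const_mul]
        · exact fun k _ => (continuous_const.mul
            (continuous_eChar.comp (by fun_prop))).intervalIntegrable _ _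
      simp_rw [hin]
      rw [intervalIntegral.integral_finsetSum]
      · simp_rw [intervalIntegral.integral_const_mul]
      · intro k _
        refine (continuous_const.mul ?_).intervalIntegrable _ _
        refine intervalIntegral.continuous_parametric_intervalIntegral_of_continuous' ?_ _ _
        exact continuous_eChar.comp (by fun_prop)
    rw [h1, Finset.sum_div]
    refine Finset.sum_congr rfl fun k _ => ?_
    rw [double_integral_eChar, hb, ← eChar_nat_mul, ← eChar_add]
    have : (k : ℝ) * -θ + (k : ℝ) ^ 2 * τ = ((k : ℝ) ^ 2 - 2 * N * k) * τ := by
      rw [hτ]; field_simp; ring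
    rw [this]
    ring
  have hbk : ∀ k ∈ Finset.range N, ‖b k * (eChar (-θ) ^ k * (1 - eChar ((k : ℝ) ^ 2 * τ)))‖ ≤
      6 / c ^ 2 * (N : ℝ) ^ (-(1 / 2) : ℝ) * (1 / k) := by
    intro k hk
    rcases Nat.eq_zero_or_pos k with rfl | hk1
    · simp [eChar_zero]
    have hk0 : (0 : ℝ) < k := by exact_mod_cast hk1
    have hb1 : ‖b k‖ ≤ 2 / c ^ 2 * ((k : ℝ) ^ 2)⁻¹ := by
      rw [hb, norm_mul, ha, one_mul]
      exact norm_average_coeff_le hc hk1 (Finset.mem_range.1 hk)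
    -- Uses `τ ≤ 1/(2N)` and `π ≤ 4`: the square is at most `8k²/N ≤ 9k²/N`.
    have hb2 : ‖1 - eChar ((k : ℝ) ^ 2 * τ)‖ ≤ 3 * k * (N : ℝ) ^ (-(1 / 2) : ℝ) := by
      refine le_of_sq_le_sq ?_ (by positivity)
      rw [norm_sub_rev]
      refine (norm_eChar_sub_one_sq_le _).trans ?_
      have hp : ((N : ℝ) ^ (-(1 / 2) : ℝ)) ^ 2 = (N : ℝ)⁻¹ := by
        rw [← Real.rpow_natCast, ← Real.rpow_mul hN0.le, ← Real.rpow_neg_one]; norm_num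
      rw [mul_pow, mul_pow, hp, abs_of_nonneg (by positivity)]
      have h5 : τ ≤ (N : ℝ)⁻¹ / 2 := by
        refine hτ1.trans ?_
        rw [hh]
        have : 2 * (c / (4 * N)) = c * ((N : ℝ)⁻¹ / 2) := by field_simp; norm_num
        rw [this]
        exact mul_le_of_le_one_left (by positivity) hc1
      calc 4 * Real.pi * ((k : ℝ) ^ 2 * τ) ≤ 4 * 4 * ((k : ℝ) ^ 2 * ((N : ℝ)⁻¹ / 2)) := by
            gcongr; exact Real.pi_le_four
        _ ≤ 3 ^ 2 * (k : ℝ) ^ 2 * (N : ℝ)⁻¹ := by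
            have : 0 ≤ (k : ℝ) ^ 2 * (N : ℝ)⁻¹ := by positivity
            nlinarith
    rw [norm_mul, norm_mul, norm_pow, norm_eChar, one_pow, one_mul]
    refine (mul_le_mul hb1 hb2 (norm_nonneg _) (by positivity)).trans_eq ?_
    field_simp; norm_num
  have hsum : ‖∑ k ∈ Finset.range N, b k * (eChar (-θ) ^ k * (1 - eChar ((k : ℝ) ^ 2 * τ)))‖ ≤
      30 / c ^ 2 * (N : ℝ) ^ (-(1 / 4) : ℝ) := by
    refine (norm_sum_le_of_le _ hbk).trans ?_
    rw [← Finset.mul_sum]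
    have h6 : ∑ k ∈ Finset.range N, (1 : ℝ) / k ≤ ∑ k ∈ Finset.Icc 1 N, (1 : ℝ) / k := by
      rw [← Finset.sum_subset (s₁ := Finset.Ioo 0 N)]
      · exact Finset.sum_le_sum_of_subset_of_nonneg
          (fun k hk => by rw [Finset.mem_Ioo] at hk; rw [Finset.mem_Icc]; omega)
          fun k _ _ => by positivity
      · intro k hk; rw [Finset.mem_Ioo] at hk; rw [Finset.mem_range]; omega
      · intro k hk hk'
        rw [Finset.mem_range] at hk
        rw [Finset.mem_Ioo] at hk'
        have : k = 0 := by omega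
        simp [this]
    refine (mul_le_mul_of_nonneg_left (h6.trans (sum_inv_le N hN)) (by positivity)).trans_eq ?_
    have : (N : ℝ) ^ (-(1 / 4) : ℝ) = (N : ℝ) ^ (-(1 / 2) : ℝ) * (N : ℝ) ^ (1 / 4 : ℝ) := by
      rw [← Real.rpow_add hN0]; norm_num
    rw [this]; ring
  have hsplit : ∑ k ∈ Finset.range N, b k * eChar (-θ) ^ k =
      (∫ s in (0 : ℝ)..h, ∫ r in (0 : ℝ)..h, g (τ + s + r)) / (h : ℂ) ^ 2 +
      ∑ k ∈ Finset.range N, b k * (eChar (-θ) ^ k * (1 - eChar ((k : ℝ) ^ 2 * τ))) := by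
    rw [← havg, ← Finset.sum_add_distrib]
    exact Finset.sum_congr rfl fun k _ => by ring
  rw [hsplit]
  refine (norm_add_le _ _).trans (add_le_add ?_ hsum)
  rw [norm_div, norm_pow, Complex.norm_real, Real.norm_of_nonneg hh0.le, h4]
  rw [div_le_div_iff₀ (by positivity) hh0]
  have := norm_double_integral_le hgc hh0.le hτ0 hτ1
  nlinarith

/-- Uniform lower bound for the mean square of the exponential sum on a window of length `c/N`. -/
lemma exists_window_lower_bound {c : ℝ} (hc : 0 < c) (hc1 : c ≤ 1) :
    ∃ κ : ℝ, 0 < κ ∧ ∃ N₀ : ℕ, 1 ≤ N₀ ∧ ∀ N : ℕ, N₀ ≤ N → ∀ a : ℕ → ℂ, (∀ k, ‖a k‖ = 1) →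
      κ * (c / N) ≤ ∫ t in (0 : ℝ)..(c / N), ‖∑ k ∈ Finset.range N,
        a k * eChar (((k : ℝ) ^ 2 - 2 * N * k) * t)‖ ^ 2 := by
  set M := ⌈1 / c⌉₊ with hM
  have hM1 : 1 ≤ M := Nat.one_le_ceil_iff.2 (by positivity)
  have hM0 : (0 : ℝ) < M := by exact_mod_cast hM1
  have hMc : 1 / (M : ℝ) ≤ c := by
    rw [div_le_iff₀ hM0, mul_comm, ← div_le_iff₀ hc]; exact Nat.le_ceil _
  set B : ℝ := 1 + 4 / c ^ 2 with hB
  have hB1 : 1 ≤ B := by rw [hB]; linarith [show 0 ≤ 4 / c ^ 2 by positivity]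
  have hB0 : 0 < B := by linarith
  set r : ℝ := (B ^ (M - 1))⁻¹ with hr
  have hr0 : 0 < r := by positivity
  have hlim : Filter.Tendsto (fun N : ℕ => 30 / c ^ 2 * (N : ℝ) ^ (-(1 / 4) : ℝ)) Filter.atTop
      (nhds 0) := by
    have h1 := (tendsto_rpow_neg_atTop (show (0 : ℝ) < 1 / 4 by norm_num)).comp
      tendsto_natCast_atTop_atTop
    simpa using h1.const_mul (30 / c ^ 2)
  obtain ⟨N₁, hN₁⟩ := Filter.eventually_atTop.1 (hlim.eventually_le_const (half_pos hr0))
  -- With `w = c/N`, the `L¹` norm is at least `(r/2)(w/4) = rw/8`; Cauchy–Schwarz squares the `8`.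
  refine ⟨r ^ 2 / 64, by positivity, max 1 N₁, le_max_left _ _, fun N hN a ha => ?_⟩
  have hN1 : 1 ≤ N := (le_max_left _ _).trans hN
  have hN0 : (0 : ℝ) < N := by exact_mod_cast hN1
  have hD := hN₁ N ((le_max_right _ _).trans hN)
  set b : ℕ → ℂ := fun k => a k *
    ((∫ s in (0 : ℝ)..(c / (4 * N)), eChar (((k : ℝ) ^ 2 - 2 * N * k) * s)) ^ 2 /
      ((c / (4 * N) : ℝ) : ℂ) ^ 2) with hb
  have hb0 : ‖b 0‖ = 1 := by
    have hne : ((c / (4 * N) : ℝ) : ℂ) ≠ 0 := by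
      have : (0 : ℝ) < c / (4 * N) := by positivity
      exact_mod_cast this.ne'
    have h0 : ∀ s : ℝ, eChar ((((0 : ℕ) : ℝ) ^ 2 - 2 * N * ((0 : ℕ) : ℝ)) * s) = 1 := by
      intro s; simp [eChar_zero]
    simp only [hb]
    simp_rw [h0]
    rw [intervalIntegral.integral_const, sub_zero, Complex.real_smul, mul_one,
      div_self (pow_ne_zero 2 hne), mul_one, ha]
  have hbB : ∑ k ∈ Finset.range N, ‖b k‖ ≤ B := by
    obtain ⟨n, rfl⟩ : ∃ n, N = n + 1 := ⟨N - 1, by omega⟩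
    have hIoo : ∑ k ∈ Finset.range (n + 1), ‖b k‖ = ‖b 0‖ + ∑ k ∈ Finset.Ioo 0 (n + 1), ‖b k‖ := by
      rw [← Finset.add_sum_erase _ _ (Finset.mem_range.2 (Nat.succ_pos n))]
      congr 1
      refine Finset.sum_congr ?_ fun _ _ => rfl
      ext k
      simp only [Finset.mem_erase, Finset.mem_range, Finset.mem_Ioo]
      omega
    rw [hIoo, hb0, hB]
    gcongr
    calc ∑ k ∈ Finset.Ioo 0 (n + 1), ‖b k‖
        ≤ ∑ k ∈ Finset.Ioo 0 (n + 1), 2 / c ^ 2 * ((k : ℝ) ^ 2)⁻¹ := by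
          refine Finset.sum_le_sum fun k hk => ?_
          rw [Finset.mem_Ioo] at hk
          simp only [hb]
          rw [norm_mul, ha, one_mul]
          exact norm_average_coeff_le hc hk.1 hk.2
      _ ≤ 2 / c ^ 2 * 2 := by
          rw [← Finset.mul_sum]
          gcongr
          simpa using sum_Ioo_inv_sq_le (α := ℝ) 0 (n + 1)
      _ = 4 / c ^ 2 := by ring
  set A := ∫ t in (0 : ℝ)..(c / N), ‖∑ k ∈ Finset.range N,
        a k * eChar (((k : ℝ) ^ 2 - 2 * N * k) * t)‖ with hA
  have hone := one_le_mul_pow_of_arc_bound hN1 hM1 hb0 hbB fun θ hθ =>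
    norm_polynomial_le hc hc1 hN1 ha (fun _ => rfl) hθ.1 (hθ.2.trans hMc)
  rw [← hA] at hone
  have hrle : r ≤ A / (c / (4 * N)) + 30 / c ^ 2 * (N : ℝ) ^ (-(1 / 4) : ℝ) := by
    rw [hr, inv_le_iff_one_le_mul₀ (by positivity)]
    exact hone
  have hAle : r / 2 * (c / (4 * N)) ≤ A := by
    rw [← le_div_iff₀ (by positivity)]; linarith
  have hCS := sq_integral_norm_le (g := fun t => ∑ k ∈ Finset.range N,
    a k * eChar (((k : ℝ) ^ 2 - 2 * N * k) * t))
    (continuous_finsetSum _ fun k _ => continuous_const.mul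
      (continuous_eChar.comp (by fun_prop))) (show 0 < c / N by positivity)
  rw [← hA] at hCS
  have hsq := (pow_le_pow_left₀ (by positivity) hAle 2).trans hCS
  refine le_of_mul_le_mul_left (le_trans (le_of_eq ?_) hsq) (show 0 < c / N by positivity)
  field_simp; norm_num

/-! ### Lower bound: transfer to `u` and tiling. -/

/-- Reversing `n = N - k` pulls out the phase of the top frequency `N²`; `x` and `t₀` survive only
in unimodular coefficients, hence uniformity in both. -/
lemma norm_schrodingerSum_eq (N : ℕ) (x t₀ t : ℝ) :
    ‖schrodingerSum N x (t₀ + t)‖ = ‖∑ k ∈ Finset.range N,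
      eChar (x * ((N : ℝ) - k) + t₀ * ((k : ℝ) ^ 2 - 2 * N * k)) *
        eChar (((k : ℝ) ^ 2 - 2 * N * k) * t)‖ := by
  have h : schrodingerSum N x (t₀ + t) = eChar ((t₀ + t) * (N : ℝ) ^ 2) *
      ∑ k ∈ Finset.range N, eChar (x * ((N : ℝ) - k) + t₀ * ((k : ℝ) ^ 2 - 2 * N * k)) *
        eChar (((k : ℝ) ^ 2 - 2 * N * k) * t) := by
    unfold schrodingerSum
    rw [Finset.mul_sum]
    refine Finset.sum_nbij' (fun n => N - n) (fun k => N - k) ?_ ?_ ?_ ?_ ?_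
    · intro n hn; rw [Finset.mem_Icc] at hn; rw [Finset.mem_range]; omega
    · intro k hk; rw [Finset.mem_range] at hk; rw [Finset.mem_Icc]; omega
    · intro n hn; rw [Finset.mem_Icc] at hn; omega
    · intro k hk; rw [Finset.mem_range] at hk; omega
    · intro n hn
      rw [Finset.mem_Icc] at hn
      rw [Nat.cast_sub hn.2, ← eChar_add, ← eChar_add]
      congr 1
      ring
  rw [h, norm_mul, norm_eChar, one_mul]

/-- Summing the window bound over adjacent windows: every time interval of length at least `c/N`
carries mean square bounded below. -/
lemma exists_timeIntegral_lower_bound {c : ℝ} (hc : 0 < c) :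
    ∃ κ : ℝ, 0 < κ ∧ ∃ N₀ : ℕ, 1 ≤ N₀ ∧ ∀ N : ℕ, N₀ ≤ N → ∀ x t₀ δ : ℝ, c / N ≤ δ →
      κ * δ ≤ ∫ t in t₀..(t₀ + δ), ‖schrodingerSum N x t‖ ^ 2 := by
  set d := min c 1 with hd
  have hd0 : 0 < d := lt_min hc one_pos
  obtain ⟨κ, hκ, N₀, hN₀, H⟩ := exists_window_lower_bound hd0 (min_le_right _ _)
  refine ⟨κ / 2, half_pos hκ, N₀, hN₀, fun N hN x t₀ δ hδ => ?_⟩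
  have hN0 : (0 : ℝ) < N := by exact_mod_cast hN₀.trans hN
  set w := d / N with hw
  have hw0 : 0 < w := by positivity
  have hwδ : w ≤ δ := le_trans (by rw [hw]; gcongr; exact min_le_left _ _) hδ
  have hcont : Continuous fun t => ‖schrodingerSum N x t‖ ^ 2 :=
    ((continuous_schrodingerSum N).comp (by fun_prop : Continuous fun t : ℝ => (x, t))).norm.pow 2
  have hwin : ∀ s, κ * w ≤ ∫ t in s..(s + w), ‖schrodingerSum N x t‖ ^ 2 := by
    intro s
    have h1 : ∫ t in s..(s + w), ‖schrodingerSum N x t‖ ^ 2 =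
        ∫ t in (0 : ℝ)..w, ‖schrodingerSum N x (s + t)‖ ^ 2 := by
      rw [intervalIntegral.integral_comp_add_left (fun t => ‖schrodingerSum N x t‖ ^ 2), add_zero]
    rw [h1]
    simp_rw [norm_schrodingerSum_eq]
    exact H N hN _ fun k => norm_eChar _
  have hmul : ∀ m : ℕ, m * (κ * w) ≤ ∫ t in t₀..(t₀ + m * w), ‖schrodingerSum N x t‖ ^ 2 := by
    intro m
    induction m with
    | zero => simp
    | succ m ih =>
      rw [← intervalIntegral.integral_add_adjacent_intervals (b := t₀ + m * w)
        (hcont.intervalIntegrable _ _) (hcont.intervalIntegrable _ _)]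
      have h2 := hwin (t₀ + m * w)
      rw [show t₀ + ((m + 1 : ℕ) : ℝ) * w = t₀ + m * w + w by push_cast; ring]
      push_cast
      linarith
  set m := ⌊δ / w⌋₊ with hm
  have hm1 : (m : ℝ) * w ≤ δ := by
    rw [← le_div_iff₀ hw0]; exact Nat.floor_le (div_nonneg (hw0.le.trans hwδ) hw0.le)
  have hm2 : δ < (m + 1) * w := by
    rw [← div_lt_iff₀ hw0]; exact Nat.lt_floor_add_one _
  have hm3 : (1 : ℝ) ≤ m := by
    have : 1 ≤ m := Nat.le_floor (by rw [Nat.cast_one, le_div_iff₀ hw0]; linarith)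
    exact_mod_cast this
  have hmono : ∫ t in t₀..(t₀ + m * w), ‖schrodingerSum N x t‖ ^ 2 ≤
      ∫ t in t₀..(t₀ + δ), ‖schrodingerSum N x t‖ ^ 2 :=
    intervalIntegral.integral_mono_interval le_rfl
      (by linarith [mul_pos (by linarith : 0 < (m : ℝ)) hw0])
      (by linarith) (Filter.Eventually.of_forall fun t => by positivity)
      (hcont.intervalIntegrable _ _)
  refine le_trans ?_ ((hmul m).trans hmono)
  -- As `m ≥ 1`, whole windows fill at least half of the interval, hence the constant `κ / 2`.
  have hδ2 : δ ≤ 2 * (m * w) := by nlinarith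
  nlinarith

theorem corollary11p1 :
    (∀ ε : ℝ, 0 < ε → ∃ N₀ : ℕ, ∀ N : ℕ, N₀ ≤ N →
      ∀ x₀ ∈ Set.Ico (0 : ℝ) 1, ∀ t₀ ∈ Set.Ico (0 : ℝ) 1,
      ∀ δ : ℝ, (N : ℝ) ^ (-(3 / 8) : ℝ) ≤ δ →
        ∃ t ∈ Set.Icc t₀ (t₀ + δ),
          localMass N x₀ δ t ≤ δ * (N : ℝ) ^ (5 / 4 + ε : ℝ)) ∧
    (∀ c : ℝ, 0 < c → ∃ κ : ℝ, 0 < κ ∧ ∃ N₀ : ℕ, ∀ N : ℕ, N₀ ≤ N →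
      ∀ x₀ ∈ Set.Ico (0 : ℝ) 1, ∀ t₀ ∈ Set.Ico (0 : ℝ) 1,
      ∀ δ : ℝ, c / (N : ℝ) ≤ δ →
        ∃ t ∈ Set.Icc t₀ (t₀ + δ),
          κ * δ ≤ localMass N x₀ δ t) := by
  constructor
  · intro ε hε
    exact ⟨51 ^ 4, fun N hN x₀ _ t₀ _ δ hδ => exists_localMass_le_rpow hε hN x₀ t₀ hδ⟩
  · intro c hc
    obtain ⟨κ, hκ, N₀, hN₀, H⟩ := exists_timeIntegral_lower_bound hc
    refine ⟨κ, hκ, N₀, fun N hN x₀ _ t₀ _ δ hδ => ?_⟩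
    have hN0 : (0 : ℝ) < N := by exact_mod_cast hN₀.trans hN
    exact exists_le_localMass (lt_of_lt_of_le (by positivity) hδ) fun x => H N hN x t₀ δ hδ
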